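/- Let $X$ be a real random variable with $\mathbb{E}\,\rho^X<\infty$ for every real $\rho>0$. For $z\in\mathbb{C}\setminus\{0\}$ put $f_X(z)=\mathbb{E}\,z^X$, where $z^r:=\exp(r\log z)$ with the principal branch of the logarithm, and put $u_X(z)=\log|f_X(z)|$. Let $\mu=\mathbb{E}X$, let $\sigma$ be the standard deviation of $X$, suppose $\sigma>0$, and let $X^*=(X-\mu)/\sigma$. Let $0<\delta\le\pi$ and $\kappa>0$, and let $S(\delta)=\{z\in\mathbb{C}\setminus\{0\}:|\arg z|<\delta\}$ (principal argument). Suppose that $f_X$ has no zeros in $S(\delta)$ and that $u_X$ satisfies the $(\kappa,\delta)$-growth condition $$\lim_{|z|\to\infty,\ z\in S(\delta)}\frac{|u_X(z)|}{|z|^{\kappa}}=0\qquad\text{and}\qquad \lim_{|z|\to\infty,\ z\in S(\delta)}\frac{|u_X(1/z)|}{|z|^{\kappa}}=0 .$$ Then, for $Z\sim N(0,1)$, $$\sup_{t\in\mathbb{R}}\bigl|\mathbb{P}(X^*\le t)-\mathbb{P}(Z\le t)\bigr|\;\le\;2^{3258}\cdot\frac{\max\{\delta^{-1},\kappa\}}{\sigma}.$$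 In particular the left-hand side is $O\bigl(\max\{\delta^{-1},\kappa\}/\sigma\bigr)$ with an absolute implied constant. -/

import Mathlib

open MeasureTheory ProbabilityTheory Filter Topology

/-- The (open) sector `{z ≠ 0 : |arg z| < δ}`. -/
def sector (δ : ℝ) : Set ℂ := {z : ℂ | z ≠ 0 ∧ |Complex.arg z| < δ}

/-- The probability generating function `f_X(z) = 𝔼 z^X` of a real random variable `X`, where
`z^r = exp (r log z)` with the principal branch of the logarithm. -/
noncomputable def probGenFun {Ω : Type*} [MeasurableSpace Ω] (X : Ω → ℝ) (P : Measure Ω)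
    (z : ℂ) : ℂ :=
  ∫ ω, Complex.exp ((X ω : ℂ) * Complex.log z) ∂P

/-- The logarithmic potential `u_X(z) = log |f_X(z)|`. -/
noncomputable def logPotential {Ω : Type*} [MeasurableSpace Ω] (X : Ω → ℝ) (P : Measure Ω)
    (z : ℂ) : ℝ :=
  Real.log ‖probGenFun X P z‖

/-- The `(κ, δ)`-growth condition: `|u(z)| / |z|^κ → 0` and `|u(1/z)| / |z|^κ → 0` as `|z| → ∞`
with `z` in the sector `|arg z| < δ`. -/
def GrowthCondition (κ δ : ℝ) (u : ℂ → ℝ) : Prop :=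
  Tendsto (fun z : ℂ => |u z| / ‖z‖ ^ κ) (Bornology.cobounded ℂ ⊓ 𝓟 (sector δ)) (𝓝 0) ∧
  Tendsto (fun z : ℂ => |u (1 / z)| / ‖z‖ ^ κ) (Bornology.cobounded ℂ ⊓ 𝓟 (sector δ)) (𝓝 0)

/-- The standard deviation of a real random variable. -/
noncomputable def stdDev {Ω : Type*} [MeasurableSpace Ω] (X : Ω → ℝ) (P : Measure Ω) : ℝ :=
  Real.sqrt (variance X P)

/-- The standardization `X* = (X - 𝔼 X) / σ`. -/
noncomputable def standardize {Ω : Type*} [MeasurableSpace Ω] (X : Ω → ℝ) (P : Measure Ω)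
    (ω : Ω) : ℝ :=
  (X ω - ∫ ω', X ω' ∂P) / stdDev X P

/-! Substituting z = exp w turns f_X into the entire function M(w) = E exp(wX). The sector becomes
the strip |Im w| < δ, where M has no zeros and log|M| grows at most like exp(κ|Re w|). Moreover M is
real on the real axis and |M(w)| ≤ M(Re w).

The central point is that L = M'/M maps the upper half of a disc of radius h = 1/(2 max(1/δ, κ))
about 0 to the closed upper half-plane. Phragmén–Lindelöf, applied to M(w)/M(w - 2iφ) on φ ≤ Im w ≤
2φ, shows that reflection in the line Im w = φ away from the axis does not increase |M|.
Infinitesimally, |M| does not increase with height, that is, Im L ≥ 0 (`norm_le_norm_sub_two_mul_I`,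
`logDeriv_im_nonneg`).

A function with this sign property and real symmetry is typically real, so its Taylor coefficients
are controlled by the first one (Rogosinski, `norm_taylorCoeff_mul_pow_le`). For L that coefficient
is L'(0) = σ². Hence L(w) = μ + σ²w + O(σ²|w|²/h), and integration gives log M(w) = μw + σ²w²/2 +
O(σ²|w|³/h) (`exists_complexMGF_eq_exp`). All cumulant control thus comes from the variance alone.

On the imaginary axis this compares the characteristic function of X, for frequencies up to a
multiple of h, with a Gaussian one. Esseen smoothing with the Fejér kernel (`abs_cdf_sub_cdf_le`)
converts this into a Kolmogorov distance O(1/(σh)). -/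

/-! ### Coefficient bounds for typically real functions. -/

/-- `|sin (n x)| ≤ n |sin x|`. -/
theorem abs_sin_natCast_mul_le (n : ℕ) (x : ℝ) : |Real.sin (n * x)| ≤ n * |Real.sin x| := by
  induction n with
  | zero => simp
  | succ n ih =>
    have h : ((n + 1 : ℕ) : ℝ) * x = n * x + x := by push_cast; ring
    rw [h, Real.sin_add]
    calc |Real.sin (n * x) * Real.cos x + Real.cos (n * x) * Real.sin x|
        ≤ |Real.sin (n * x)| * |Real.cos x| + |Real.cos (n * x)| * |Real.sin x| := by
          rw [← abs_mul, ← abs_mul]; exact abs_add_le _ _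
      _ ≤ |Real.sin (n * x)| * 1 + 1 * |Real.sin x| := by
          gcongr
          · exact Real.abs_cos_le_one _
          · exact Real.abs_cos_le_one _
      _ ≤ ((n + 1 : ℕ) : ℝ) * |Real.sin x| := by push_cast; linarith

theorem integral_exp_neg_mul_circleMap {f : ℂ → ℂ} {r : ℝ} (hr : 0 < r)
    (hf : DifferentiableOn ℂ f (Metric.closedBall 0 r)) (n : ℕ) :
    ∫ θ in (0 : ℝ)..2 * Real.pi, Complex.exp (-(n * θ * Complex.I)) * f (circleMap 0 r θ)
      = 2 * Real.pi * ((n.factorial : ℂ)⁻¹ * iteratedDeriv n f 0) * r ^ n := by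
  have h := hf.circleIntegral_one_div_sub_center_pow_smul hr n
  rw [circleIntegral] at h
  have hr' : (r : ℂ) ≠ 0 := by exact_mod_cast hr.ne'
  have h2 : ∀ θ : ℝ, deriv (circleMap 0 r) θ • (1 / (circleMap 0 r θ - 0) ^ (n + 1)) •
      f (circleMap 0 r θ)
      = (Complex.I * (r ^ n : ℂ)⁻¹) *
        (Complex.exp (-(n * θ * Complex.I)) * f (circleMap 0 r θ)) := by
    intro θ
    have h3 : circleMap 0 r θ ≠ 0 := circleMap_ne_center hr.ne'
    have h4 : Complex.exp (-(n * θ * Complex.I)) = (circleMap 0 r θ ^ n)⁻¹ * r ^ n := by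
      rw [circleMap, zero_add, mul_pow, ← Complex.exp_nat_mul, Complex.exp_neg]
      field_simp
    rw [deriv_circleMap, h4]
    simp only [smul_eq_mul, sub_zero]
    field_simp
    ring
  simp_rw [h2] at h
  rw [intervalIntegral.integral_const_mul] at h
  have h5 : (Complex.I * (r ^ n : ℂ)⁻¹) ≠ 0 := by simp [hr']
  apply mul_left_cancel₀ h5
  rw [h, smul_eq_mul]
  field_simp

/-- Cauchy's theorem for z ^ n * f z: a holomorphic function has no negative frequencies on the
circle. The index is n + 1 because dz contributes one more power of z. -/
theorem integral_exp_mul_circleMap {f : ℂ → ℂ} {r : ℝ} (hr : 0 < r)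
    (hf : DifferentiableOn ℂ f (Metric.closedBall 0 r)) (n : ℕ) :
    ∫ θ in (0 : ℝ)..2 * Real.pi,
      Complex.exp ((n + 1 : ℕ) * θ * Complex.I) * f (circleMap 0 r θ) = 0 := by
  have hd : DiffContOnCl ℂ (fun z => z ^ n * f z) (Metric.ball 0 r) := by
    apply DifferentiableOn.diffContOnCl
    rw [closure_ball _ hr.ne']
    exact (by fun_prop : DifferentiableOn ℂ (fun z : ℂ => z ^ n) _).mul hf
  have h := hd.circleIntegral_eq_zero hr.le
  rw [circleIntegral] at h
  have hr' : (r : ℂ) ≠ 0 := by exact_mod_cast hr.ne'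
  have h2 : ∀ θ : ℝ, deriv (circleMap 0 r) θ • (circleMap 0 r θ ^ n * f (circleMap 0 r θ))
      = (Complex.I * r ^ (n + 1)) *
        (Complex.exp ((n + 1 : ℕ) * θ * Complex.I) * f (circleMap 0 r θ)) := by
    intro θ
    have h4 : Complex.exp ((n + 1 : ℕ) * θ * Complex.I) * r ^ (n + 1)
        = circleMap 0 r θ ^ (n + 1) := by
      rw [circleMap, zero_add, mul_pow, ← Complex.exp_nat_mul, mul_comm, mul_assoc]
    rw [deriv_circleMap, smul_eq_mul]
    calc _ = Complex.I * (circleMap 0 r θ ^ (n + 1)) * f (circleMap 0 r θ) := by ring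
      _ = _ := by rw [← h4]; ring
  simp_rw [h2] at h
  rw [intervalIntegral.integral_const_mul] at h
  have h5 : (Complex.I * (r : ℂ) ^ (n + 1)) ≠ 0 := by simp [hr']
  exact (mul_eq_zero.mp h).resolve_left h5

/-- The Taylor coefficients at `0` of a function that is real on the real axis are sine
coefficients of its imaginary part. -/
theorem taylorCoeff_eq_integral_im_mul_sin {f : ℂ → ℂ} {r : ℝ} (hr : 0 < r)
    (hf : DifferentiableOn ℂ f (Metric.closedBall 0 r))
    (hconj : ∀ z ∈ Metric.closedBall (0 : ℂ) r,
      f (starRingEnd ℂ z) = starRingEnd ℂ (f z)) (n : ℕ) :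
    (((n + 1).factorial : ℂ)⁻¹ * iteratedDeriv (n + 1) f 0) * r ^ (n + 1)
      = ((1 / Real.pi * ∫ θ in (0 : ℝ)..2 * Real.pi,
          (f (circleMap 0 r θ)).im * Real.sin ((n + 1 : ℕ) * θ) : ℝ) : ℂ) := by
  have hcont : Continuous (fun θ : ℝ => f (circleMap 0 r θ)) := by
    refine hf.continuousOn.comp_continuous (continuous_circleMap 0 r) fun θ => ?_
    exact circleMap_mem_closedBall _ hr.le _
  set N : ℕ := n + 1 with hN
  have e1 := integral_exp_neg_mul_circleMap hr hf N
  have e2 := integral_exp_mul_circleMap hr hf n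
  rw [← hN] at e2
  -- Of the two exponentials in the sine, only the one with negative frequency survives.
  have hs : ∫ θ in (0 : ℝ)..2 * Real.pi, f (circleMap 0 r θ) * Complex.sin (N * θ)
      = Real.pi * Complex.I * (((N.factorial : ℂ)⁻¹ * iteratedDeriv N f 0) * r ^ N) := by
    have h1 : ∀ θ : ℝ, f (circleMap 0 r θ) * Complex.sin (N * θ)
        = Complex.I / 2 * (Complex.exp (-(N * θ * Complex.I)) * f (circleMap 0 r θ)
          - Complex.exp (N * θ * Complex.I) * f (circleMap 0 r θ)) := by
      intro θ
      rw [Complex.sin, neg_mul]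
      ring
    simp_rw [h1]
    rw [intervalIntegral.integral_const_mul, intervalIntegral.integral_sub, e1, e2]
    · ring
    · exact (Continuous.mul (by fun_prop) hcont).intervalIntegrable _ _
    · exact (Continuous.mul (by fun_prop) hcont).intervalIntegrable _ _
  have hrefl : ∀ θ : ℝ, f (circleMap 0 r (2 * Real.pi - θ))
      = starRingEnd ℂ (f (circleMap 0 r θ)) := by
    intro θ
    rw [← hconj _ (circleMap_mem_closedBall _ hr.le _)]
    congr 1
    rw [circleMap, circleMap, zero_add, zero_add, map_mul, ← Complex.exp_conj, Complex.conj_ofReal]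
    congr 1
    rw [map_mul, Complex.conj_I, Complex.conj_ofReal]
    push_cast
    rw [sub_mul, Complex.exp_sub, Complex.exp_two_pi_mul_I, mul_neg, Complex.exp_neg, one_div]
  -- Substituting 2π - θ conjugates f and flips the sine, so the real part of f contributes nothing.
  have hs2 : ∫ θ in (0 : ℝ)..2 * Real.pi, f (circleMap 0 r θ) * Complex.sin (N * θ)
      = - ∫ θ in (0 : ℝ)..2 * Real.pi,
        starRingEnd ℂ (f (circleMap 0 r θ)) * Complex.sin (N * θ) := by
    have h := intervalIntegral.integral_comp_sub_left (a := 0) (b := 2 * Real.pi)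
      (fun θ : ℝ => f (circleMap 0 r θ) * Complex.sin (N * θ)) (2 * Real.pi)
    rw [sub_self, sub_zero] at h
    rw [← h, ← intervalIntegral.integral_neg]
    congr 1
    ext θ
    rw [hrefl]
    push_cast
    rw [mul_sub, Complex.sin_nat_mul_two_pi_sub]
    ring
  have hs3 : ∫ θ in (0 : ℝ)..2 * Real.pi, f (circleMap 0 r θ) * Complex.sin (N * θ)
      = Complex.I * ((∫ θ in (0 : ℝ)..2 * Real.pi,
          (f (circleMap 0 r θ)).im * Real.sin (N * θ) : ℝ) : ℂ) := by
    have h1 : ∫ θ in (0 : ℝ)..2 * Real.pi, f (circleMap 0 r θ) * Complex.sin (N * θ)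
        = (1 / 2 : ℂ) * ((∫ θ in (0 : ℝ)..2 * Real.pi, f (circleMap 0 r θ) * Complex.sin (N * θ))
          - ∫ θ in (0 : ℝ)..2 * Real.pi,
            starRingEnd ℂ (f (circleMap 0 r θ)) * Complex.sin (N * θ)) := by
      linear_combination (1 / 2 : ℂ) * hs2
    rw [h1, ← intervalIntegral.integral_ofReal, ← intervalIntegral.integral_sub,
      ← intervalIntegral.integral_const_mul, ← intervalIntegral.integral_const_mul]
    · congr 1
      ext θ
      rw [← sub_mul, Complex.sub_conj]
      push_cast
      ring
    · exact (hcont.mul (by fun_prop)).intervalIntegrable _ _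
    · apply Continuous.intervalIntegrable
      exact (Complex.continuous_conj.comp hcont).mul (by fun_prop)
  have hpi : (Real.pi : ℂ) ≠ 0 := by exact_mod_cast Real.pi_ne_zero
  have h6 := hs.symm.trans hs3
  apply mul_left_cancel₀ (mul_ne_zero hpi Complex.I_ne_zero)
  rw [h6]
  push_cast
  field_simp

/-- Rogosinski's coefficient bound for typically real functions on a closed disc. -/
theorem norm_taylorCoeff_mul_pow_le {f : ℂ → ℂ} {r : ℝ} (hr : 0 < r)
    (hf : DifferentiableOn ℂ f (Metric.closedBall 0 r))
    (hconj : ∀ z ∈ Metric.closedBall (0 : ℂ) r,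
      f (starRingEnd ℂ z) = starRingEnd ℂ (f z))
    (him : ∀ z ∈ Metric.closedBall (0 : ℂ) r, 0 ≤ z.im → 0 ≤ (f z).im) (n : ℕ) :
    ‖((n + 1).factorial : ℂ)⁻¹ * iteratedDeriv (n + 1) f 0‖ * r ^ (n + 1)
      ≤ (n + 1) * (‖iteratedDeriv 1 f 0‖ * r) := by
  have hcont : Continuous (fun θ : ℝ => f (circleMap 0 r θ)) := by
    refine hf.continuousOn.comp_continuous (continuous_circleMap 0 r) fun θ => ?_
    exact circleMap_mem_closedBall _ hr.le _
  -- Im f and sin θ have the same sign on the whole circle (by conjugation on the lower half). So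
  -- |Im f · sin (kθ)| ≤ k · Im f · sin θ, and the right side integrates to the first coefficient.
  have hsign : ∀ θ : ℝ, |(f (circleMap 0 r θ)).im| * |Real.sin θ|
      = (f (circleMap 0 r θ)).im * Real.sin θ := by
    intro θ
    have hz : (circleMap 0 r θ).im = r * Real.sin θ := by simp [circleMap, Complex.exp_ofReal_mul_I_im]
    have hmem : circleMap 0 r θ ∈ Metric.closedBall (0 : ℂ) r := circleMap_mem_closedBall _ hr.le _
    rw [← abs_mul, abs_of_nonneg]
    rcases le_total 0 (Real.sin θ) with h | h
    · exact mul_nonneg (him _ hmem (by rw [hz]; positivity)) h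
    · refine mul_nonneg_of_nonpos_of_nonpos ?_ h
      have hmem' : starRingEnd ℂ (circleMap 0 r θ) ∈ Metric.closedBall (0 : ℂ) r := by
        simpa using hmem
      have := him _ hmem' (by
        rw [Complex.conj_im, hz]
        nlinarith)
      rw [hconj _ hmem, Complex.conj_im] at this
      linarith
  have key : ∀ m : ℕ, ‖((m + 1).factorial : ℂ)⁻¹ * iteratedDeriv (m + 1) f 0‖ * r ^ (m + 1)
      = |1 / Real.pi * ∫ θ in (0 : ℝ)..2 * Real.pi,
          (f (circleMap 0 r θ)).im * Real.sin ((m + 1 : ℕ) * θ)| := by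
    intro m
    have h := congrArg norm (taylorCoeff_eq_integral_im_mul_sin hr hf hconj m)
    rw [norm_mul, norm_pow, Complex.norm_real, Complex.norm_real, Real.norm_eq_abs,
      Real.norm_eq_abs, abs_of_pos hr] at h
    exact h
  have h1 := key 0
  simp only [zero_add, Nat.factorial_one, Nat.cast_one, inv_one, one_mul, pow_one] at h1
  rw [key n, h1, abs_mul, abs_mul, mul_left_comm]
  refine mul_le_mul_of_nonneg_left ?_ (abs_nonneg _)
  calc |∫ θ in (0 : ℝ)..2 * Real.pi, (f (circleMap 0 r θ)).im * Real.sin ((n + 1 : ℕ) * θ)|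
      ≤ ∫ θ in (0 : ℝ)..2 * Real.pi,
          |(f (circleMap 0 r θ)).im * Real.sin ((n + 1 : ℕ) * θ)| :=
        intervalIntegral.abs_integral_le_integral_abs (by positivity)
    _ ≤ ∫ θ in (0 : ℝ)..2 * Real.pi, (n + 1) * ((f (circleMap 0 r θ)).im * Real.sin θ) := by
        apply intervalIntegral.integral_mono_on (by positivity)
        · exact ((Complex.continuous_im.comp hcont).mul (by fun_prop)).abs.intervalIntegrable _ _
        · exact (((Complex.continuous_im.comp hcont).mul
            Real.continuous_sin).const_mul _).intervalIntegrable _ _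
        · intro θ _
          rw [← hsign, abs_mul]
          have := abs_sin_natCast_mul_le (n + 1) θ
          have h3 := mul_le_mul_of_nonneg_left this (abs_nonneg (f (circleMap 0 r θ)).im)
          push_cast at h3 ⊢
          linarith
    _ ≤ _ := by
        rw [intervalIntegral.integral_const_mul]
        exact mul_le_mul_of_nonneg_left (le_abs_self _) (by positivity)

/-- Second order Taylor remainder of a typically real function. -/
theorem norm_sub_affine_le_of_typicallyReal {f : ℂ → ℂ} {R : ℝ} (hR : 0 < R)
    (hf : DifferentiableOn ℂ f (Metric.ball 0 R))
    (hconj : ∀ z ∈ Metric.ball (0 : ℂ) R, f (starRingEnd ℂ z) = starRingEnd ℂ (f z))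
    (him : ∀ z ∈ Metric.ball (0 : ℂ) R, 0 ≤ z.im → 0 ≤ (f z).im) {w : ℂ} (hw : ‖w‖ ≤ R / 2) :
    ‖f w - f 0 - deriv f 0 * w‖ ≤ 6 * ‖deriv f 0‖ * ‖w‖ ^ 2 / R := by
  set a : ℕ → ℂ := fun n => ((n.factorial : ℂ)⁻¹ * iteratedDeriv n f 0) with ha
  have hcoef : ∀ n : ℕ, ‖a (n + 1)‖ * R ^ (n + 1) ≤ (n + 1) * (‖deriv f 0‖ * R) := by
    intro n
    -- The coefficient bound needs a closed disc, so it is applied for r < R and passed to the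
    -- limit.
    have hev : ∀ᶠ r in 𝓝[<] R, ‖a (n + 1)‖ * r ^ (n + 1) ≤ (n + 1) * (‖deriv f 0‖ * r) := by
      filter_upwards [Ioo_mem_nhdsLT hR] with r hr
      have hsub : Metric.closedBall (0 : ℂ) r ⊆ Metric.ball 0 R :=
        Metric.closedBall_subset_ball hr.2
      have := norm_taylorCoeff_mul_pow_le hr.1 (hf.mono hsub) (fun z hz => hconj z (hsub hz))
        (fun z hz => him z (hsub hz)) n
      rwa [iteratedDeriv_one] at this
    refine le_of_tendsto_of_tendsto (b := 𝓝[<] R) ?_ ?_ hev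
    · exact (Continuous.tendsto (by fun_prop) R).mono_left nhdsWithin_le_nhds
    · exact (Continuous.tendsto (by fun_prop) R).mono_left nhdsWithin_le_nhds
  have hmem : w ∈ Metric.ball (0 : ℂ) R := by
    rw [mem_ball_zero_iff]; linarith
  have hsum := Complex.hasSum_taylorSeries_on_ball hf hmem
  have hsum2 : HasSum (fun n => a (n + 2) * w ^ (n + 2)) (f w - f 0 - deriv f 0 * w) := by
    have h := (hasSum_nat_add_iff' 2).mpr hsum
    simp only [sub_zero, smul_eq_mul, Finset.sum_range_succ, Finset.sum_range_zero,
      Nat.factorial_zero, Nat.factorial_one, Nat.cast_one, inv_one, pow_zero, pow_one, one_mul,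
      iteratedDeriv_zero, iteratedDeriv_one, zero_add] at h
    convert! h using 1
    · ext n; simp only [ha]; ring
    · ring
  -- With |w|/R ≤ 1/2 the tail is dominated by the sum of (n + 2)/2^n, which is 6.
  have hg : HasSum (fun n : ℕ => (‖deriv f 0‖ * ‖w‖ ^ 2 / R) * ((n : ℝ) * (1 / 2) ^ n
      + 2 * (1 / 2) ^ n)) (6 * ‖deriv f 0‖ * ‖w‖ ^ 2 / R) := by
    have h1 := hasSum_coe_mul_geometric_of_norm_lt_one (𝕜 := ℝ) (r := 1 / 2) (by norm_num)
    have h2 := (hasSum_geometric_of_lt_one (r := (1 / 2 : ℝ)) (by norm_num) (by norm_num)).mul_left 2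
    have h3 := (h1.add h2).mul_left (‖deriv f 0‖ * ‖w‖ ^ 2 / R)
    have e : 6 * ‖deriv f 0‖ * ‖w‖ ^ 2 / R
        = ‖deriv f 0‖ * ‖w‖ ^ 2 / R * (1 / 2 / (1 - 1 / 2) ^ 2 + 2 * (1 - 1 / 2)⁻¹) := by
      norm_num
      ring
    rw [e]
    exact h3
  rw [← hsum2.tsum_eq]
  refine tsum_of_norm_bounded hg fun n => ?_
  have hq : ‖w‖ / R ≤ 1 / 2 := by rw [div_le_iff₀ hR]; linarith
  have hq0 : 0 ≤ ‖w‖ / R := by positivity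
  calc ‖a (n + 2) * w ^ (n + 2)‖ = (‖a (n + 1 + 1)‖ * R ^ (n + 1 + 1)) * (‖w‖ / R) ^ (n + 2) := by
        rw [norm_mul, norm_pow, div_pow]; field_simp
    _ ≤ (((n + 1 : ℕ) + 1) * (‖deriv f 0‖ * R)) * (‖w‖ / R) ^ (n + 2) := by
        exact mul_le_mul_of_nonneg_right (hcoef (n + 1)) (by positivity)
    _ = (‖deriv f 0‖ * ‖w‖ ^ 2 / R) * (((n : ℝ) + 2) * (‖w‖ / R) ^ n) := by
        rw [pow_add, div_pow _ _ 2]; push_cast; field_simp; ring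
    _ ≤ (‖deriv f 0‖ * ‖w‖ ^ 2 / R) * (((n : ℝ) + 2) * (1 / 2) ^ n) := by
        gcongr
    _ = _ := by ring

/-! ### Reflection and the sign of the logarithmic derivative. -/

/-- A reflection principle of Phragmén–Lindelöf type: if `‖M‖` is largest on the real axis and
`log ‖M‖` grows slowly in the strip, then `‖M‖` decreases under reflection away from the axis. -/
theorem norm_le_norm_sub_two_mul_I {M : ℂ → ℂ} (hM : Differentiable ℂ M)
    (hconj : ∀ w, M (starRingEnd ℂ w) = starRingEnd ℂ (M w))
    (hdom : ∀ w : ℂ, ‖M w‖ ≤ ‖M w.re‖) {δ κ : ℝ}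
    (hnz : ∀ w : ℂ, |w.im| < δ → M w ≠ 0)
    (hgrow : ∃ A : ℝ, ∀ w : ℂ, |w.im| < δ → A ≤ |w.re| →
      |Real.log ‖M w‖| ≤ Real.exp (κ * |w.re|))
    {φ : ℝ} (hφ : 0 < φ) (hφδ : 2 * φ < δ) (hφκ : κ * φ < Real.pi) {w : ℂ}
    (hw₁ : φ ≤ w.im) (hw₂ : w.im ≤ 2 * φ) :
    ‖M w‖ ≤ ‖M (w - 2 * φ * Complex.I)‖ := by
  have him : ∀ z : ℂ, (z - 2 * φ * Complex.I).im = z.im - 2 * φ := by intro z; simp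
  have hre : ∀ z : ℂ, (z - 2 * φ * Complex.I).re = z.re := by intro z; simp
  have hs1 : ∀ z : ℂ, φ ≤ z.im → z.im ≤ 2 * φ → |z.im| < δ := by
    intro z h1 h2; rw [abs_lt]; constructor <;> linarith
  have hs2 : ∀ z : ℂ, φ ≤ z.im → z.im ≤ 2 * φ → |(z - 2 * φ * Complex.I).im| < δ := by
    intro z h1 h2; rw [him, abs_lt]; constructor <;> linarith
  -- On the edge Im z = φ the shifted point is the conjugate of z, so |F| = 1. On Im z = 2φ it is Re
  -- z, so `hdom` gives |F| ≤ 1.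
  set F : ℂ → ℂ := fun z => M z / M (z - 2 * φ * Complex.I) with hF
  have hclosed : IsClosed (Complex.im ⁻¹' Set.Icc φ (2 * φ)) :=
    isClosed_Icc.preimage Complex.continuous_im
  have hFd : DiffContOnCl ℂ F (Complex.im ⁻¹' Set.Ioo φ (2 * φ)) := by
    apply DifferentiableOn.diffContOnCl
    have hsub : closure (Complex.im ⁻¹' Set.Ioo φ (2 * φ)) ⊆ Complex.im ⁻¹' Set.Icc φ (2 * φ) :=
      closure_minimal (Set.preimage_mono Set.Ioo_subset_Icc_self) hclosed
    intro z hz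
    have hz' := hsub hz
    have hd : DifferentiableAt ℂ (fun z => M (z - 2 * φ * Complex.I)) z :=
      (hM (z - 2 * φ * Complex.I)).comp z (by fun_prop)
    exact ((hM z).div hd (hnz _ (hs2 z hz'.1 hz'.2))).differentiableWithinAt
  have hFle : ‖F w‖ ≤ 1 := by
    refine PhragmenLindelof.horizontal_strip hFd ?_ ?_ ?_ hw₁ hw₂
    -- The strip has width φ, so the critical rate is π/φ > κ. The factor 2 counts numerator and
    -- denominator.
    · refine ⟨κ, ?_, 2, ?_⟩
      · rw [lt_div_iff₀ (by linarith)]; linarith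
      · obtain ⟨A, hA⟩ := hgrow
        apply Asymptotics.IsBigO.of_bound 1
        have h1 : ∀ᶠ z : ℂ in comap (abs ∘ Complex.re) atTop, A ≤ |z.re| :=
          (eventually_ge_atTop A).comap _
        filter_upwards [h1.filter_mono inf_le_left, mem_inf_of_right (mem_principal_self _)]
          with z hzA hz
        have g1 := hs1 z hz.1.le hz.2.le
        have g2 := hs2 z hz.1.le hz.2.le
        have b1 := hA z g1 hzA
        have b2 := hA _ g2 (by rwa [hre])
        rw [hre] at b2
        have p1 : 0 < ‖M z‖ := norm_pos_iff.mpr (hnz z g1)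
        have p2 : 0 < ‖M (z - 2 * φ * Complex.I)‖ := norm_pos_iff.mpr (hnz _ g2)
        rw [one_mul, Real.norm_eq_abs, Real.abs_exp, hF]
        simp only
        rw [norm_div, ← Real.exp_log (div_pos p1 p2), Real.log_div p1.ne' p2.ne']
        apply Real.exp_le_exp.mpr
        have := abs_le.mp b1
        have := abs_le.mp b2
        linarith
    · intro z hz
      have p2 : 0 < ‖M (z - 2 * φ * Complex.I)‖ :=
        norm_pos_iff.mpr (hnz _ (hs2 z hz.ge (by linarith)))
      rw [hF]
      simp only
      rw [norm_div, div_le_one p2]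
      have : z - 2 * φ * Complex.I = starRingEnd ℂ z := by
        apply Complex.ext
        · rw [hre, Complex.conj_re]
        · rw [him, Complex.conj_im, hz]; ring
      rw [this, hconj, RCLike.norm_conj]
    · intro z hz
      have p2 : 0 < ‖M (z - 2 * φ * Complex.I)‖ :=
        norm_pos_iff.mpr (hnz _ (hs2 z (by linarith) hz.le))
      rw [hF]
      simp only
      rw [norm_div, div_le_one p2]
      have : z - 2 * φ * Complex.I = (z.re : ℂ) := by
        apply Complex.ext
        · rw [hre, Complex.ofReal_re]
        · rw [him, Complex.ofReal_im, hz]; ring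
      rw [this]
      exact hdom z
  have p2 : 0 < ‖M (w - 2 * φ * Complex.I)‖ := norm_pos_iff.mpr (hnz _ (hs2 w hw₁ hw₂))
  rw [hF] at hFle
  simp only at hFle
  rwa [norm_div, div_le_one p2] at hFle

/-- Under the hypotheses of `norm_le_norm_sub_two_mul_I`, the logarithmic derivative of `M` maps
the upper part of a narrower strip to the closed upper half-plane. -/
theorem logDeriv_im_nonneg {M : ℂ → ℂ} (hM : Differentiable ℂ M)
    (hconj : ∀ w, M (starRingEnd ℂ w) = starRingEnd ℂ (M w))
    (hdom : ∀ w : ℂ, ‖M w‖ ≤ ‖M w.re‖) {δ κ : ℝ}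
    (hnz : ∀ w : ℂ, |w.im| < δ → M w ≠ 0)
    (hgrow : ∃ A : ℝ, ∀ w : ℂ, |w.im| < δ → A ≤ |w.re| →
      |Real.log ‖M w‖| ≤ Real.exp (κ * |w.re|))
    {w : ℂ} (hw : 0 < w.im) (hwδ : 2 * w.im < δ) (hwκ : κ * w.im < Real.pi) :
    0 ≤ (logDeriv M w).im := by
  have hg : ∀ c : ℂ, HasDerivAt (fun t : ℝ => ‖M (w + t * c)‖ ^ 2)
      (2 * (starRingEnd ℂ (M w) * (deriv M w * c)).re) 0 := by
    intro c
    have h1 : HasDerivAt (fun t : ℝ => w + t * c) c 0 := by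
      have := ((Complex.ofRealCLM.hasDerivAt (x := 0)).mul_const c).const_add w
      simpa using this
    have h2 : HasDerivAt (fun t : ℝ => M (w + t * c)) (deriv M w * c) 0 := by
      have h3 : HasDerivAt M (deriv M w) (w + (0 : ℝ) * c) := by
        simpa using (hM w).hasDerivAt
      exact h3.comp (0 : ℝ) h1
    have h4 := h2.norm_sq
    simp only [Complex.ofReal_zero, zero_mul, add_zero, Complex.inner] at h4
    rw [mul_comm (starRingEnd ℂ (M w))]
    exact h4
  -- This is twice the vertical derivative of |M|², which is a negative multiple of |M|² Im (M'/M).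
  -- Reflection in the line through w makes its difference quotients nonpositive.
  have hp := ((hg Complex.I).sub (hg (-Complex.I))).tendsto_slope_zero_right
  have hle := le_of_tendsto (b := 0) hp ?_
  · have hMw : 0 < Complex.normSq (M w) := Complex.normSq_pos.mpr (hnz w (by
      rw [abs_of_pos hw]; linarith))
    rw [logDeriv_apply, Complex.div_im]
    simp only [Complex.mul_re, Complex.mul_im, Complex.conj_re, Complex.conj_im, Complex.I_re,
      Complex.I_im, Complex.neg_re, Complex.neg_im] at hle
    rw [div_sub_div_same]
    apply div_nonneg _ hMw.le
    linarith
  · filter_upwards [Ioo_mem_nhdsGT hw] with t ht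
    have h := norm_le_norm_sub_two_mul_I hM hconj hdom hnz hgrow hw hwδ hwκ
      (w := w + t * Complex.I) (by simpa using ht.1.le) (by simp; linarith [ht.2])
    have e : ‖M (w + t * Complex.I - 2 * w.im * Complex.I)‖ = ‖M (w + t * (-Complex.I))‖ := by
      rw [← RCLike.norm_conj, ← hconj]
      congr 2
      apply Complex.ext <;> simp
      ring
    rw [e] at h
    have h2 : ‖M (w + t * Complex.I)‖ ^ 2 ≤ ‖M (w + t * (-Complex.I))‖ ^ 2 := by gcongr
    simp only [smul_eq_mul, zero_add, Pi.sub_apply, Complex.ofReal_zero, zero_mul, add_zero,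
      sub_self, sub_zero]
    exact mul_nonpos_of_nonneg_of_nonpos (inv_nonneg.mpr ht.1.le) (by linarith)

/-! ### The Fejér kernel. -/

/-- The (unnormalised) Fejér kernel on the real line. -/
noncomputable def fejerKernel (x : ℝ) : ℝ := Real.sinc (x / 2) ^ 2

theorem continuous_fejerKernel : Continuous fejerKernel := by
  unfold fejerKernel
  exact (Real.continuous_sinc.comp (by fun_prop)).pow 2

theorem fejerKernel_nonneg (x : ℝ) : 0 ≤ fejerKernel x := sq_nonneg _

theorem fejerKernel_le_one (x : ℝ) : fejerKernel x ≤ 1 := by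
  have := Real.abs_sinc_le_one (x / 2)
  exact (sq_le_one_iff_abs_le_one _).mpr this

theorem fejerKernel_mul_sq_le (x : ℝ) : fejerKernel x * x ^ 2 ≤ 4 := by
  rcases eq_or_ne x 0 with rfl | hx
  · simp
  · rw [fejerKernel, Real.sinc_of_ne_zero (by simpa using hx)]
    have := Real.sin_sq_le_one (x / 2)
    field_simp
    linarith

theorem integrable_fejerKernel : Integrable fejerKernel := by
  refine (integrable_inv_one_add_sq.const_mul 5).mono'
    continuous_fejerKernel.aestronglyMeasurable (ae_of_all _ fun x => ?_)
  rw [Real.norm_eq_abs, abs_of_nonneg (fejerKernel_nonneg x), ← div_eq_mul_inv,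
    le_div_iff₀ (by positivity)]
  linarith [fejerKernel_le_one x, fejerKernel_mul_sq_le x]

theorem half_le_fejerKernel {x : ℝ} (hx : |x| ≤ 1) : 1 / 2 ≤ fejerKernel x := by
  have key : ∀ y : ℝ, 0 < y → y ≤ 1 → 1 / 2 ≤ fejerKernel y := by
    intro y hy hy1
    have h := Real.sin_gt_sub_cube (x := y / 2) (by linarith)
    have h2 : 3 / 4 ≤ Real.sinc (y / 2) := by
      rw [Real.sinc_of_ne_zero (by linarith), le_div_iff₀ (by linarith)]
      have : (y / 2) ^ 3 ≤ y / 2 := pow_le_of_le_one (by linarith) (by linarith) (by norm_num)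
      linarith
    rw [fejerKernel]
    nlinarith
  rcases lt_trichotomy x 0 with h | h | h
  · have := key (-x) (by linarith) (by rw [abs_of_neg h] at hx; exact hx)
    rwa [fejerKernel, neg_div, Real.sinc_neg] at this
  · rw [h, fejerKernel]; norm_num
  · exact key x h (by rwa [abs_of_pos h] at hx)

theorem one_le_integral_fejerKernel : 1 ≤ ∫ x, fejerKernel x := by
  calc (1 : ℝ) = ∫ _ in Set.Icc (-1 : ℝ) 1, (1 / 2 : ℝ) := by
        rw [setIntegral_const]; norm_num [Measure.real]
    _ ≤ ∫ x in Set.Icc (-1 : ℝ) 1, fejerKernel x := by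
        refine setIntegral_mono_on (integrableOn_const (by simp)) integrable_fejerKernel.integrableOn
          measurableSet_Icc fun x hx => half_le_fejerKernel (abs_le.mpr hx)
    _ ≤ _ := setIntegral_le_integral integrable_fejerKernel (ae_of_all _ fejerKernel_nonneg)

/-- The Fejér kernel is the Fourier transform of the triangle function. -/
theorem integral_triangle_mul_exp (x : ℝ) :
    ∫ t in (-1 : ℝ)..1, ((1 - |t| : ℝ) : ℂ) * Complex.exp (t * x * Complex.I)
      = (fejerKernel x : ℂ) := by
  have hc : Continuous (fun t : ℝ => ((1 - |t| : ℝ) : ℂ) * Complex.exp (t * x * Complex.I)) := by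
    fun_prop
  rw [← intervalIntegral.integral_add_adjacent_intervals (hc.intervalIntegrable (-1) 0)
    (hc.intervalIntegrable 0 1)]
  have h1 := intervalIntegral.integral_comp_neg (a := 0) (b := 1)
    (fun t : ℝ => ((1 - |t| : ℝ) : ℂ) * Complex.exp (t * x * Complex.I))
  rw [neg_zero] at h1
  rw [← h1, ← intervalIntegral.integral_add]
  · have h2 : ∫ t in (0 : ℝ)..1, (((1 - |-t| : ℝ) : ℂ) * Complex.exp ((-t : ℝ) * x * Complex.I)
        + ((1 - |t| : ℝ) : ℂ) * Complex.exp (t * x * Complex.I))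
        = ((∫ t in (0 : ℝ)..1, 2 * (1 - t) * Real.cos (t * x) : ℝ) : ℂ) := by
      rw [← intervalIntegral.integral_ofReal]
      apply intervalIntegral.integral_congr
      intro t ht
      rw [Set.uIcc_of_le zero_le_one] at ht
      simp only [abs_neg, abs_of_nonneg ht.1]
      push_cast
      rw [Complex.cos, neg_mul, neg_mul]
      ring_nf
    rw [h2]
    congr 1
    rcases eq_or_ne x 0 with rfl | hx
    · simp only [mul_zero, Real.cos_zero, mul_one, fejerKernel, zero_div, Real.sinc_zero, one_pow]
      rw [intervalIntegral.integral_const_mul, intervalIntegral.integral_sub (by simp) (by simp)]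
      norm_num
    · have hder : ∀ t ∈ Set.uIcc (0 : ℝ) 1, HasDerivAt
          (fun t => 2 * (1 - t) * Real.sin (t * x) / x - 2 * Real.cos (t * x) / x ^ 2)
          (2 * (1 - t) * Real.cos (t * x)) t := by
        intro t _
        have hl : HasDerivAt (fun t : ℝ => t * x) x t := by
          simpa using (hasDerivAt_id t).mul_const x
        have ha : HasDerivAt (fun t : ℝ => 2 * (1 - t)) (-2) t := by
          simpa using ((hasDerivAt_id t).const_sub 1).const_mul 2
        have := ((ha.mul hl.sin).div_const x).sub ((hl.cos.const_mul 2).div_const (x ^ 2))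
        convert! this using 1
        field_simp
        ring
      rw [intervalIntegral.integral_eq_sub_of_hasDerivAt hder
        (Continuous.intervalIntegrable (by fun_prop) _ _)]
      have hcos : Real.cos x = 1 - 2 * Real.sin (x / 2) ^ 2 := by
        have := Real.cos_sq_add_sin_sq (x / 2)
        have h3 := Real.cos_two_mul (x / 2)
        rw [mul_div_cancel₀ x two_ne_zero] at h3
        rw [h3]; linarith
      rw [fejerKernel, Real.sinc_of_ne_zero (by simpa using hx)]
      simp only [one_mul, zero_mul, Real.cos_zero, Real.sin_zero, hcos]
      field_simp
      ring
  · exact Continuous.intervalIntegrable (by fun_prop) _ _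
  · exact hc.intervalIntegrable _ _

/-- Averaging against the Fejér kernel detects a lower bound on a window of length `256`, up to
half the supremum norm. -/
theorem le_integral_fejerKernel_mul_add {H : ℝ → ℝ} (hH : Measurable H) {D h₀ c : ℝ}
    (hD : ∀ x, |H x| ≤ D) (hh : ∀ y, |y| ≤ 128 → h₀ ≤ H (c - y)) (h₀pos : 0 ≤ h₀) :
    h₀ ≤ (∫ y, fejerKernel y * H (c - y)) + D / 2 := by
  have hhD : h₀ ≤ D := by
    have := hh 0 (by simp)
    exact this.trans ((le_abs_self _).trans (hD _))
  have hint : Integrable (fun y => fejerKernel y * H (c - y)) := by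
    refine integrable_fejerKernel.mul_bdd (c := D) ?_ (ae_of_all _ fun y => ?_)
    · exact (hH.comp (measurable_const.sub measurable_id)).aestronglyMeasurable
    · exact hD _
  have hint2 : Integrable (fun y : ℝ => (1 + (y / 128) ^ 2)⁻¹) :=
    integrable_inv_one_add_sq.comp_div (by norm_num)
  have hval : ∫ y : ℝ, (1 + (y / 128) ^ 2)⁻¹ = 128 * Real.pi := by
    rw [Measure.integral_comp_div (fun y : ℝ => (1 + y ^ 2)⁻¹) 128, integral_univ_inv_one_add_sq]
    norm_num
  -- Outside the window H falls below h₀ by at most 2D, and the kernel is at most 8/(128² + y²)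
  -- there. The total loss is πD/8 ≤ D/2, which is why a half-width of 128 suffices.
  have hmono : ∫ y, (h₀ * fejerKernel y - (2 * D) * (8 / 128 ^ 2) * (1 + (y / 128) ^ 2)⁻¹)
      ≤ ∫ y, fejerKernel y * H (c - y) := by
    refine integral_mono ((integrable_fejerKernel.const_mul _).sub (hint2.const_mul _)) hint
      fun y => ?_
    have hk := fejerKernel_nonneg y
    have hD0 : 0 ≤ D := h₀pos.trans hhD
    simp only
    by_cases hy : |y| ≤ 128
    · have := mul_le_mul_of_nonneg_left (hh y hy) hk
      have : 0 ≤ (2 * D) * (8 / 128 ^ 2) * (1 + (y / 128) ^ 2)⁻¹ := by positivity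
      linarith
    · have hy2 : (128 : ℝ) ^ 2 ≤ y ^ 2 := by
        rw [← sq_abs y]; exact pow_le_pow_left₀ (by norm_num) (not_le.mp hy).le 2
      have h1 : fejerKernel y ≤ 8 / 128 ^ 2 * (1 + (y / 128) ^ 2)⁻¹ := by
        have e : 8 / 128 ^ 2 * (1 + (y / 128) ^ 2)⁻¹ = 8 / (128 ^ 2 + y ^ 2) := by
          field_simp
        rw [e, le_div_iff₀ (by positivity)]
        nlinarith [fejerKernel_mul_sq_le y]
      have h2 := mul_le_mul_of_nonneg_left (neg_le_of_abs_le (hD (c - y))) hk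
      have h3 := mul_le_mul_of_nonneg_left hhD hk
      have h4 := mul_le_mul_of_nonneg_left h1 (by positivity : 0 ≤ 2 * D)
      linarith
  rw [integral_sub (integrable_fejerKernel.const_mul _) (hint2.const_mul _),
    integral_const_mul, integral_const_mul, hval] at hmono
  have h1 := mul_le_mul_of_nonneg_left one_le_integral_fejerKernel h₀pos
  have hpi := Real.pi_lt_four
  have hD0 : 0 ≤ D := h₀pos.trans hhD
  nlinarith

/-! ### Esseen's smoothing inequality. -/

theorem tendsto_integral_fejerKernel_mul_cdf (μ : Measure ℝ) :
    Tendsto (fun c => ∫ y, fejerKernel y * cdf μ (c - y)) atBot (𝓝 0) := by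
  have h := tendsto_integral_filter_of_dominated_convergence (μ := volume) (l := atBot)
    (F := fun (c : ℝ) (y : ℝ) => fejerKernel y * cdf μ (c - y)) (f := fun _ => (0 : ℝ)) fejerKernel
    (Eventually.of_forall fun c => ?_) (Eventually.of_forall fun c => ae_of_all _ fun y => ?_)
    integrable_fejerKernel (ae_of_all _ fun y => ?_)
  · simpa using h
  · exact (continuous_fejerKernel.measurable.mul ((monotone_cdf μ).measurable.comp
      (measurable_const.sub measurable_id))).aestronglyMeasurable
  · rw [Real.norm_eq_abs, abs_of_nonneg (mul_nonneg (fejerKernel_nonneg y) (cdf_nonneg μ _))]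
    exact mul_le_of_le_one_right (fejerKernel_nonneg y) (cdf_le_one μ _)
  · have h1 : Tendsto (fun c : ℝ => c - y) atBot atBot := by
      simpa [sub_eq_add_neg] using tendsto_atBot_add_const_right atBot (-y) tendsto_id
    simpa using ((tendsto_cdf_atBot μ).comp h1).const_mul (fejerKernel y)

/-- By Fubini, the smoothed distribution function has as density the kernel averaged against μ. -/
theorem integral_fejerKernel_mul_cdf_sub (μ : Measure ℝ) [IsProbabilityMeasure μ] (a b : ℝ) :
    (∫ y, fejerKernel y * cdf μ (b - y)) - ∫ y, fejerKernel y * cdf μ (a - y)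
      = ∫ c in a..b, ∫ x, fejerKernel (c - x) ∂μ := by
  have hprod : ∀ c : ℝ, Integrable (Function.uncurry fun y x : ℝ =>
      (Set.Iic (c - x)).indicator fejerKernel y) (volume.prod μ) := by
    intro c
    have hs : MeasurableSet {p : ℝ × ℝ | p.1 ≤ c - p.2} :=
      measurableSet_le measurable_fst (measurable_const.sub measurable_snd)
    exact (integrable_fejerKernel.comp_fst μ).indicator hs
  have hG : ∀ c : ℝ, ∫ y, fejerKernel y * cdf μ (c - y)
      = ∫ x, (∫ y in Set.Iic (c - x), fejerKernel y) ∂μ := by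
    intro c
    have h1 : ∀ y, fejerKernel y * cdf μ (c - y)
        = ∫ x, (Set.Iic (c - x)).indicator fejerKernel y ∂μ := by
      intro y
      rw [cdf_eq_real, ← integral_indicator_one measurableSet_Iic, ← integral_const_mul]
      congr 1
      ext x
      by_cases h : x ≤ c - y
      · rw [Set.indicator_of_mem (Set.mem_Iic.mpr h),
          Set.indicator_of_mem (Set.mem_Iic.mpr (by linarith))]
        simp
      · rw [Set.indicator_of_notMem (by simpa using h),
          Set.indicator_of_notMem (by simp; linarith)]
        simp
    simp_rw [h1]
    rw [integral_integral_swap (hprod c)]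
    simp_rw [integral_indicator measurableSet_Iic]
  have hint : ∀ c : ℝ, Integrable (fun x => ∫ y in Set.Iic (c - x), fejerKernel y) μ := by
    intro c
    have h := (hprod c).integral_prod_right
    simp only [Function.uncurry_apply_pair, integral_indicator measurableSet_Iic] at h
    exact h
  rw [hG, hG, ← integral_sub (hint b) (hint a), intervalIntegral_integral_swap]
  · congr 1
    ext x
    rw [intervalIntegral.integral_Iic_sub_Iic integrable_fejerKernel.integrableOn
      integrable_fejerKernel.integrableOn, intervalIntegral.integral_comp_sub_right]
  · have : IsFiniteMeasure (volume.restrict (Set.uIoc a b)) := ⟨by simp [Set.uIoc]⟩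
    refine Integrable.of_bound (C := 1) ?_ (ae_of_all _ fun p => ?_)
    · exact (continuous_fejerKernel.comp (by fun_prop)).aestronglyMeasurable
    · rw [Function.uncurry, Real.norm_eq_abs, abs_of_nonneg (fejerKernel_nonneg _)]
      exact fejerKernel_le_one _

/-- The Fourier transform of the kernel is supported in [-1, 1], so only the values of the
characteristic function there enter. -/
theorem integral_fejerKernel_sub_eq (μ : Measure ℝ) [IsProbabilityMeasure μ] (c : ℝ) :
    ((∫ x, fejerKernel (c - x) ∂μ : ℝ) : ℂ)
      = ∫ t in (-1 : ℝ)..1, ((1 - |t| : ℝ) : ℂ) * Complex.exp (t * c * Complex.I)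
          * charFun μ (-t) := by
  rw [← integral_complex_ofReal]
  simp_rw [← integral_triangle_mul_exp]
  rw [← intervalIntegral_integral_swap]
  · congr 1
    ext t
    rw [charFun_apply_real, ← integral_const_mul]
    congr 1
    ext x
    rw [mul_assoc, mul_assoc, ← Complex.exp_add]
    push_cast
    ring_nf
  · have : IsFiniteMeasure (volume.restrict (Set.uIoc (-1 : ℝ) 1)) := ⟨by simp [Set.uIoc]⟩
    refine Integrable.of_bound (C := 1) ?_ ?_
    · apply Continuous.aestronglyMeasurable
      unfold Function.uncurry
      fun_prop
    · have h := Measure.quasiMeasurePreserving_fst (μ := volume.restrict (Set.uIoc (-1 : ℝ) 1))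
        (ν := μ) |>.ae (ae_restrict_mem measurableSet_uIoc)
      filter_upwards [h] with p hp
      rw [Set.uIoc_of_le (by norm_num)] at hp
      have hp' : |p.1| ≤ 1 := abs_le.mpr ⟨hp.1.le, hp.2⟩
      rw [Function.uncurry, norm_mul, Complex.norm_real, ← Complex.ofReal_mul,
        Complex.norm_exp_ofReal_mul_I, mul_one, Real.norm_eq_abs, abs_of_nonneg (by linarith)]
      linarith [abs_nonneg p.1]

/-- The difference of the Fejér-smoothed distribution functions is controlled by the difference of
the characteristic functions on `[-1, 1]`. -/
theorem abs_integral_fejerKernel_mul_cdf_sub_le (μ ν : Measure ℝ) [IsProbabilityMeasure μ]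
    [IsProbabilityMeasure ν] {w : ℝ → ℝ} (hw : Continuous w) (hw0 : ∀ t, 0 ≤ w t)
    (hφ : ∀ t, |t| ≤ 1 → ‖charFun μ t - charFun ν t‖ ≤ |t| * w t) (b : ℝ) :
    |∫ y, fejerKernel y * (cdf μ (b - y) - cdf ν (b - y))| ≤ 2 * ∫ t in (-1 : ℝ)..1, w (-t) := by
  have hintk : ∀ (ρ : Measure ℝ) (c : ℝ), Integrable (fun y => fejerKernel y * cdf ρ (c - y)) := by
    intro ρ c
    refine integrable_fejerKernel.mul_bdd (c := 1) ?_ (ae_of_all _ fun y => ?_)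
    · exact ((monotone_cdf ρ).measurable.comp
        (measurable_const.sub measurable_id)).aestronglyMeasurable
    · rw [Real.norm_eq_abs, abs_of_nonneg (cdf_nonneg ρ _)]
      exact cdf_le_one ρ _
  have hsub : ∀ c, ∫ y, fejerKernel y * (cdf μ (c - y) - cdf ν (c - y))
      = (∫ y, fejerKernel y * cdf μ (c - y)) - ∫ y, fejerKernel y * cdf ν (c - y) := by
    intro c
    rw [← integral_sub (hintk μ c) (hintk ν c)]
    simp_rw [mul_sub]
  have hck : ∀ (ρ : Measure ℝ) [IsProbabilityMeasure ρ],
      Continuous fun c => ∫ x, fejerKernel (c - x) ∂ρ := by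
    intro ρ _
    refine continuous_of_dominated (bound := fun _ => 1) ?_ ?_ (integrable_const _) ?_
    · intro c
      exact (continuous_fejerKernel.comp (by fun_prop)).aestronglyMeasurable
    · intro c
      refine ae_of_all _ fun x => ?_
      rw [Real.norm_eq_abs, abs_of_nonneg (fejerKernel_nonneg _)]
      exact fejerKernel_le_one _
    · exact ae_of_all _ fun x => continuous_fejerKernel.comp (by fun_prop)
  set D : ℝ → ℂ := fun t => charFun μ (-t) - charFun ν (-t) with hD
  have hDc : Continuous D := by fun_prop
  -- Integrating exp(itc) over c in [a, b] first gives at most 2/|t| whatever a is. This cancels the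
  -- factor |t| in `hφ`, so a may then tend to -∞.
  have hdiff : ∀ a : ℝ, |(∫ y, fejerKernel y * (cdf μ (b - y) - cdf ν (b - y)))
      - ∫ y, fejerKernel y * (cdf μ (a - y) - cdf ν (a - y))|
      ≤ 2 * ∫ t in (-1 : ℝ)..1, w (-t) := by
    intro a
    have e1 : (∫ y, fejerKernel y * (cdf μ (b - y) - cdf ν (b - y)))
        - ∫ y, fejerKernel y * (cdf μ (a - y) - cdf ν (a - y))
        = ∫ c in a..b, ((∫ x, fejerKernel (c - x) ∂μ) - ∫ x, fejerKernel (c - x) ∂ν) := by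
      rw [intervalIntegral.integral_sub ((hck μ).intervalIntegrable _ _)
        ((hck ν).intervalIntegrable _ _), ← integral_fejerKernel_mul_cdf_sub,
        ← integral_fejerKernel_mul_cdf_sub, hsub, hsub]
      ring
    have e2 : ∀ c : ℝ,
        (((∫ x, fejerKernel (c - x) ∂μ) - ∫ x, fejerKernel (c - x) ∂ν : ℝ) : ℂ)
        = ∫ t in (-1 : ℝ)..1,
          ((1 - |t| : ℝ) : ℂ) * Complex.exp (t * c * Complex.I) * D t := by
      intro c
      rw [Complex.ofReal_sub, integral_fejerKernel_sub_eq, integral_fejerKernel_sub_eq,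
        ← intervalIntegral.integral_sub]
      · simp_rw [hD, mul_sub]
      · exact Continuous.intervalIntegrable (by fun_prop) _ _
      · exact Continuous.intervalIntegrable (by fun_prop) _ _
    rw [e1, ← Real.norm_eq_abs, ← Complex.norm_real, ← intervalIntegral.integral_ofReal]
    simp_rw [e2]
    rw [intervalIntegral_intervalIntegral_swap]
    · have hwi : Continuous fun t => 2 * w (-t) := by fun_prop
      rw [← intervalIntegral.integral_const_mul]
      refine intervalIntegral.norm_integral_le_of_norm_le (by norm_num)
        (ae_of_all _ fun t ht => ?_) (hwi.intervalIntegrable _ _)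
      have ht1 : |t| ≤ 1 := abs_le.mpr ⟨ht.1.le, ht.2⟩
      have e3 : ∀ c : ℝ, ((1 - |t| : ℝ) : ℂ) * Complex.exp (t * c * Complex.I) * D t
          = ((1 - |t| : ℝ) : ℂ) * D t * Complex.exp (t * Complex.I * c) := by
        intro c; ring_nf
      simp_rw [e3]
      rw [intervalIntegral.integral_const_mul, norm_mul, norm_mul, Complex.norm_real,
        Real.norm_eq_abs, abs_of_nonneg (by linarith : 0 ≤ 1 - |t|)]
      have hDt : ‖D t‖ ≤ |t| * w (-t) := by
        have := hφ (-t) (by rwa [abs_neg])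
        rwa [abs_neg] at this
      rcases eq_or_ne t 0 with rfl | ht0
      · rw [abs_zero, zero_mul] at hDt
        have : ‖D 0‖ = 0 := le_antisymm hDt (norm_nonneg _)
        rw [this]
        have := hw0 (-0)
        simp only [mul_zero, zero_mul]
        linarith
      · have hexp : ‖∫ c in a..b, Complex.exp (t * Complex.I * c)‖ ≤ 2 / |t| := by
          rw [integral_exp_mul_complex (by simp [ht0])]
          rw [norm_div, norm_mul, Complex.norm_I, mul_one, Complex.norm_real, Real.norm_eq_abs]
          gcongr
          refine (norm_sub_le _ _).trans ?_
          have hn : ∀ c : ℝ, ‖Complex.exp (t * Complex.I * c)‖ = 1 := by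
            intro c
            rw [mul_right_comm, ← Complex.ofReal_mul, Complex.norm_exp_ofReal_mul_I]
          rw [hn, hn]; norm_num
        have ht0' : 0 < |t| := abs_pos.mpr ht0
        calc (1 - |t|) * ‖D t‖ * ‖∫ c in a..b, Complex.exp (t * Complex.I * c)‖
            ≤ 1 * (|t| * w (-t)) * (2 / |t|) := by
              have := hw0 (-t)
              gcongr
              linarith
          _ = 2 * w (-t) := by field_simp
    · have hc : Continuous (Function.uncurry fun c t : ℝ =>
          ((1 - |t| : ℝ) : ℂ) * Complex.exp (t * c * Complex.I) * D t) := by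
        unfold Function.uncurry
        fun_prop
      refine (hc.continuousOn.integrableOn_compact
        ((isCompact_uIcc (a := a) (b := b)).prod
        (isCompact_uIcc (a := (-1 : ℝ)) (b := 1)))).mono_set ?_
      exact Set.prod_mono Set.uIoc_subset_uIcc Set.uIoc_subset_uIcc
  have hlim : Tendsto (fun a => ∫ y, fejerKernel y * (cdf μ (a - y) - cdf ν (a - y)))
      atBot (𝓝 0) := by
    simp_rw [hsub]
    simpa using (tendsto_integral_fejerKernel_mul_cdf μ).sub
      (tendsto_integral_fejerKernel_mul_cdf ν)
  have hlim2 := (hlim.const_sub (∫ y, fejerKernel y * (cdf μ (b - y) - cdf ν (b - y)))).abs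
  rw [sub_zero] at hlim2
  exact le_of_tendsto hlim2 (Eventually.of_forall hdiff)

/-- A form of Esseen's smoothing inequality. -/
theorem abs_cdf_sub_cdf_le (μ ν : Measure ℝ) [IsProbabilityMeasure μ]
    [IsProbabilityMeasure ν] {w : ℝ → ℝ} (hw : Continuous w) (hw0 : ∀ t, 0 ≤ w t)
    (hφ : ∀ t, |t| ≤ 1 → ‖charFun μ t - charFun ν t‖ ≤ |t| * w t) {ε : ℝ} (hε : 0 ≤ ε)
    (hν : ∀ x y, x ≤ y → cdf ν y - cdf ν x ≤ ε * (y - x)) (x : ℝ) :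
    |cdf μ x - cdf ν x| ≤ 512 * ε + 4 * ∫ t in (-1 : ℝ)..1, w (-t) := by
  set H : ℝ → ℝ := fun x => cdf μ x - cdf ν x with hH
  have hHm : Measurable H := (monotone_cdf μ).measurable.sub (monotone_cdf ν).measurable
  have hbdd : BddAbove (Set.range fun x => |H x|) := by
    refine ⟨1, ?_⟩
    rintro _ ⟨x, rfl⟩
    have h1 := cdf_nonneg μ x
    have h2 := cdf_nonneg ν x
    have h3 := cdf_le_one μ x
    have h4 := cdf_le_one ν x
    exact abs_le.mpr ⟨by simp only [hH]; linarith, by simp only [hH]; linarith⟩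
  set Δ : ℝ := ⨆ x, |H x| with hΔ
  have hleΔ : ∀ x, |H x| ≤ Δ := fun x => le_ciSup hbdd x
  have hΔ0 : 0 ≤ Δ := (abs_nonneg _).trans (hleΔ 0)
  set B := 2 * ∫ t in (-1 : ℝ)..1, w (-t) with hB
  have hS := abs_integral_fejerKernel_mul_cdf_sub_le μ ν hw hw0 hφ
  have hB0 : 0 ≤ B := (abs_nonneg _).trans (hS 0)
  -- Centring the window at x ± 128 puts it on one side of x, where monotonicity of `cdf μ` and the
  -- Lipschitz bound for `cdf ν` cost at most 256ε. The supremum Δ on the right is then absorbed,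
  -- doubling the constants.
  have hpt : ∀ x, |H x| ≤ 256 * ε + B + Δ / 2 := by
    intro x
    refine abs_le'.mpr ⟨?_, ?_⟩
    · by_cases h0 : 0 ≤ H x - 256 * ε
      · have h := le_integral_fejerKernel_mul_add hHm hleΔ (c := x + 128) (fun y hy => ?_) h0
        · have := (abs_le.mp (hS (x + 128))).2
          simp only [← hB] at this
          simp only [hH] at h ⊢
          linarith
        · have hy' := abs_le.mp hy
          have h1 := monotone_cdf μ (by linarith : x ≤ x + 128 - y)
          have h2 := hν x (x + 128 - y) (by linarith)
          have h3 : ε * (x + 128 - y - x) ≤ ε * 256 := by gcongr; linarith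
          simp only [hH]
          linarith
      · linarith
    · by_cases h0 : 0 ≤ -H x - 256 * ε
      · have h := le_integral_fejerKernel_mul_add (H := fun x => -H x) hHm.neg
          (fun x => by rw [abs_neg]; exact hleΔ x) (c := x - 128) (fun y hy => ?_) h0
        · have := (abs_le.mp (hS (x - 128))).1
          simp only [mul_neg, integral_neg] at h
          simp only [hH] at h ⊢
          linarith
        · have hy' := abs_le.mp hy
          have h1 := monotone_cdf μ (by linarith : x - 128 - y ≤ x)
          have h2 := hν (x - 128 - y) x (by linarith)
          have h3 : ε * (x - (x - 128 - y)) ≤ ε * 256 := by gcongr; linarith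
          simp only [hH]
          linarith
      · linarith
  have : Δ ≤ 256 * ε + B + Δ / 2 := ciSup_le hpt
  have := hleΔ x
  simp only [hH] at this
  linarith

/-! ### From the logarithmic derivative to an exponential form. -/

/-- Near the origin, a function whose logarithmic derivative is close to affine is close to the
exponential of a quadratic polynomial. -/
theorem exists_eq_exp_of_logDeriv {M : ℂ → ℂ} (hM : Differentiable ℂ M) (hM0 : M 0 = 1) {h C : ℝ}
    {a b : ℂ} (hnz : ∀ z ∈ Metric.ball (0 : ℂ) h, M z ≠ 0)
    (hL : ∀ z : ℂ, ‖z‖ ≤ h / 2 → ‖logDeriv M z - a - b * z‖ ≤ C * ‖z‖ ^ 2) (hC : 0 ≤ C)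
    (hh : 0 < h) {w : ℂ} (hw : ‖w‖ ≤ h / 2) :
    ∃ R : ℂ, M w = Complex.exp (a * w + b * w ^ 2 / 2 + R) ∧ ‖R‖ ≤ C * ‖w‖ ^ 3 := by
  have hLd : DifferentiableOn ℂ (logDeriv M) (Metric.ball 0 h) := by
    intro z hz
    exact ((hM.deriv z).div (hM z) (hnz z hz)).differentiableWithinAt
  -- A primitive of M'/M replaces a branch of log M: M exp(-G) has zero derivative, hence is
  -- constant.
  obtain ⟨G, hG⟩ := hLd.isExactOn_ball
  have hsub : Metric.closedBall (0 : ℂ) ‖w‖ ⊆ Metric.ball 0 h :=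
    Metric.closedBall_subset_ball (by linarith)
  have hw0 : (0 : ℂ) ∈ Metric.closedBall (0 : ℂ) ‖w‖ := by simp
  have hww : w ∈ Metric.closedBall (0 : ℂ) ‖w‖ := by simp
  have hN : ‖M w * Complex.exp (-G w) - M 0 * Complex.exp (-G 0)‖ ≤ 0 * ‖w - 0‖ := by
    refine (convex_closedBall (0 : ℂ) ‖w‖).norm_image_sub_le_of_norm_hasDerivWithin_le
      (f := fun z => M z * Complex.exp (-G z)) (f' := fun _ => 0)
      (fun z hz => ?_) (fun z hz => by simp) hw0 hww
    have hd := (hM z).hasDerivAt.mul (hG z (hsub hz)).neg.cexp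
    refine HasDerivAt.hasDerivWithinAt ?_
    convert! hd using 1
    rw [logDeriv_apply]
    field_simp [hnz z (hsub hz)]
    ring
  have hMw : M w = Complex.exp (G w - G 0) := by
    rw [zero_mul, norm_le_zero_iff, sub_eq_zero, hM0, one_mul] at hN
    rw [sub_eq_add_neg, Complex.exp_add, ← hN, mul_left_comm, ← Complex.exp_add]
    simp
  refine ⟨G w - G 0 - a * w - b * w ^ 2 / 2, ?_, ?_⟩
  · rw [hMw]; congr 1; ring
  · have hR := (convex_closedBall (0 : ℂ) ‖w‖).norm_image_sub_le_of_norm_hasDerivWithin_le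
      (f := fun z => G z - a * z - b * z ^ 2 / 2) (f' := fun z => logDeriv M z - a - b * z)
      (C := C * ‖w‖ ^ 2) (fun z hz => ?_) (fun z hz => ?_) hw0 hww
    · calc _ = ‖G w - a * w - b * w ^ 2 / 2 - (G 0 - a * 0 - b * 0 ^ 2 / 2)‖ := by
            congr 1; ring
        _ ≤ _ := hR
        _ = _ := by rw [sub_zero]; ring
    · refine HasDerivAt.hasDerivWithinAt ?_
      have h1 : HasDerivAt (fun z : ℂ => a * z) a z := by
        simpa using (hasDerivAt_id z).const_mul a
      have h2 : HasDerivAt (fun z : ℂ => b * z ^ 2 / 2) (b * z) z := by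
        have := (((hasDerivAt_id z).pow 2).const_mul b).div_const 2
        convert! this using 1
        simp
        ring
      exact ((hG z (hsub hz)).sub h1).sub h2
    · have hz' : ‖z‖ ≤ ‖w‖ := by simpa using hz
      exact (hL z (hz'.trans hw)).trans (by gcongr)

/-! ### The moment generating function in the strip. -/

section MGF

variable {Ω : Type*} [MeasurableSpace Ω] {P : Measure Ω} {X : Ω → ℝ}

theorem integrableExpSet_eq_univ
    (hfin : ∀ ρ : ℝ, 0 < ρ → Integrable (fun ω => ρ ^ (X ω)) P) :
    integrableExpSet X P = Set.univ := by
  ext t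
  simp only [Set.mem_univ, iff_true]
  have := hfin (Real.exp t) (Real.exp_pos t)
  simp_rw [← Real.exp_mul] at this
  exact this

theorem differentiable_complexMGF (hu : integrableExpSet X P = Set.univ) :
    Differentiable ℂ (complexMGF X P) := fun z =>
  (hasDerivAt_complexMGF (z := z) (by simp [hu])).differentiableAt

theorem complexMGF_conj (w : ℂ) :
    complexMGF X P (starRingEnd ℂ w) = starRingEnd ℂ (complexMGF X P w) := by
  rw [complexMGF, complexMGF, ← integral_conj]
  congr 1
  ext ω
  rw [← Complex.exp_conj, map_mul, Complex.conj_ofReal]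

theorem norm_complexMGF_le_norm_re (w : ℂ) :
    ‖complexMGF X P w‖ ≤ ‖complexMGF X P w.re‖ := by
  rw [complexMGF_ofReal, Complex.norm_real, Real.norm_of_nonneg mgf_nonneg]
  exact norm_complexMGF_le_mgf

theorem logDeriv_complexMGF_zero [IsProbabilityMeasure P]
    (hu : integrableExpSet X P = Set.univ) :
    logDeriv (complexMGF X P) 0 = ((∫ ω, X ω ∂P : ℝ) : ℂ) := by
  have h := (hasDerivAt_complexMGF (X := X) (μ := P) (z := 0) (by simp [hu])).deriv
  rw [logDeriv_apply, h]
  simp [complexMGF, integral_complex_ofReal]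

theorem deriv_logDeriv_complexMGF_zero [IsProbabilityMeasure P]
    (hu : integrableExpSet X P = Set.univ) :
    deriv (logDeriv (complexMGF X P)) 0 = ((variance X P : ℝ) : ℂ) := by
  have hi : (0 : ℂ).re ∈ interior (integrableExpSet X P) := by simp [hu]
  have h0 := hasDerivAt_complexMGF (X := X) (μ := P) (z := 0) hi
  have h1 : HasDerivAt (deriv (complexMGF X P))
      (∫ ω, (X ω : ℂ) ^ 2 * Complex.exp (0 * X ω) ∂P) 0 := by
    have := hasDerivAt_iteratedDeriv_complexMGF (X := X) (μ := P) (z := 0) hi 1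
    rwa [iteratedDeriv_one] at this
  have hM0 : complexMGF X P 0 = 1 := by simp [complexMGF]
  have hd := (h1.div h0 (by rw [hM0]; exact one_ne_zero)).deriv
  have e : logDeriv (complexMGF X P) = deriv (complexMGF X P) / complexMGF X P := rfl
  have hL2 : MemLp X 2 P := by
    have := memLp_of_mem_interior_integrableExpSet (X := X) (μ := P) (by simp [hu]) 2
    simpa using this
  rw [e, hd, hM0, h0.deriv, variance_eq_sub hL2]
  simp only [zero_mul, Complex.exp_zero, mul_one]
  have e2 : ∫ ω, (X ω : ℂ) ^ 2 ∂P = ((∫ ω, X ω ^ 2 ∂P : ℝ) : ℂ) := by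
    rw [← integral_complex_ofReal]; push_cast; rfl
  rw [e2, integral_complex_ofReal]
  push_cast
  simp only [Pi.pow_apply]
  ring

theorem probGenFun_exp {w : ℂ} (hw : |w.im| < Real.pi) :
    probGenFun X P (Complex.exp w) = complexMGF X P w := by
  have h := abs_lt.mp hw
  rw [probGenFun, complexMGF, Complex.log_exp h.1 h.2.le]
  simp_rw [mul_comm]

theorem exp_mem_sector {δ : ℝ} (hδπ : δ ≤ Real.pi) {w : ℂ} (hw : |w.im| < δ) :
    Complex.exp w ∈ sector δ := by
  have h := abs_lt.mp hw
  refine ⟨Complex.exp_ne_zero w, ?_⟩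
  have : Complex.arg (Complex.exp w) = w.im := by
    rw [← Complex.log_im, Complex.log_exp (by linarith) (by linarith)]
  rwa [this]

/-- Under z = exp w, |z|^κ becomes exp(κ Re w). The limit along z covers Re w → ∞ and the one along
1/z covers Re w → -∞; only an eventual bound by 1 is used. -/
theorem GrowthCondition.exists_abs_log_norm_complexMGF_le {δ κ : ℝ} (hδπ : δ ≤ Real.pi)
    (hgrowth : GrowthCondition κ δ (logPotential X P)) :
    ∃ A : ℝ, ∀ w : ℂ, |w.im| < δ → A ≤ |w.re| →
      |Real.log ‖complexMGF X P w‖| ≤ Real.exp (κ * |w.re|) := by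
  have key : ∀ v : ℂ → ℝ, Tendsto (fun z : ℂ => |v z| / ‖z‖ ^ κ)
      (Bornology.cobounded ℂ ⊓ 𝓟 (sector δ)) (𝓝 0) →
      ∃ A : ℝ, ∀ w : ℂ, |w.im| < δ → A ≤ w.re →
        |v (Complex.exp w)| ≤ Real.exp (κ * w.re) := by
    intro v hv
    have h1 := hv.eventually (gt_mem_nhds (zero_lt_one))
    rw [eventually_inf_principal] at h1
    obtain ⟨r, hr⟩ := (hasBasis_cobounded_norm (E := ℂ)).eventually_iff.mp h1
    refine ⟨Real.log (max r 1), fun w hw hwr => ?_⟩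
    have hn : ‖Complex.exp w‖ = Real.exp w.re := Complex.norm_exp w
    have h2 := hr.2 (x := Complex.exp w) (by
      rw [Set.mem_ofPred_eq, hn]
      refine (le_max_left r 1).trans ?_
      rwa [← Real.log_le_iff_le_exp (lt_of_lt_of_le one_pos (le_max_right r 1))])
      (exp_mem_sector hδπ hw)
    rw [hn, ← Real.exp_mul, div_lt_one (Real.exp_pos _), mul_comm] at h2
    exact h2.le
  obtain ⟨A₁, h₁⟩ := key _ hgrowth.1
  obtain ⟨A₂, h₂⟩ := key (fun z => logPotential X P (1 / z)) hgrowth.2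
  refine ⟨max A₁ A₂, fun w hw hA => ?_⟩
  rcases le_total 0 w.re with h | h
  · rw [abs_of_nonneg h] at hA ⊢
    have := h₁ w hw ((le_max_left _ _).trans hA)
    rwa [logPotential, probGenFun_exp (hw.trans_le hδπ)] at this
  · rw [abs_of_nonpos h] at hA ⊢
    have := h₂ (-w) (by simpa using hw) ((le_max_right _ _).trans (by simpa using hA))
    rw [one_div, ← Complex.exp_neg, neg_neg, logPotential,
      probGenFun_exp (hw.trans_le hδπ)] at this
    simpa using this

/-- Second order expansion of the logarithm of the moment generating function on a disc whose
radius is governed by the zero-free sector and the growth condition. -/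
theorem exists_complexMGF_eq_exp [IsProbabilityMeasure P] {δ κ h : ℝ}
    (hδπ : δ ≤ Real.pi)
    (hu : integrableExpSet X P = Set.univ)
    (hzero : ∀ z ∈ sector δ, probGenFun X P z ≠ 0)
    (hgrowth : GrowthCondition κ δ (logPotential X P))
    (hh : 0 < h) (hhδ : 2 * h ≤ δ) (hhκ : κ * h ≤ 1) (hκ : 0 < κ) {w : ℂ} (hw : ‖w‖ ≤ h / 2) :
    ∃ R : ℂ, complexMGF X P w
        = Complex.exp ((∫ ω, X ω ∂P : ℝ) * w + (variance X P : ℝ) * w ^ 2 / 2 + R) ∧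
      ‖R‖ ≤ 6 * variance X P / h * ‖w‖ ^ 3 := by
  have hM := differentiable_complexMGF hu
  have hnz : ∀ z : ℂ, |z.im| < δ → complexMGF X P z ≠ 0 := by
    intro z hz
    rw [← probGenFun_exp (hz.trans_le hδπ)]
    exact hzero _ (exp_mem_sector hδπ hz)
  have himlt : ∀ z ∈ Metric.ball (0 : ℂ) h, |z.im| < h := by
    intro z hz
    exact (Complex.abs_im_le_norm z).trans_lt (by simpa using hz)
  have hnzb : ∀ z ∈ Metric.ball (0 : ℂ) h, complexMGF X P z ≠ 0 := by
    intro z hz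
    exact hnz z (by linarith [himlt z hz])
  have hLd : DifferentiableOn ℂ (logDeriv (complexMGF X P)) (Metric.ball 0 h) := fun z hz =>
    ((hM.deriv z).div (hM z) (hnzb z hz)).differentiableWithinAt
  have hconj : ∀ z, logDeriv (complexMGF X P) (starRingEnd ℂ z)
      = starRingEnd ℂ (logDeriv (complexMGF X P) z) := by
    intro z
    rw [logDeriv_apply, logDeriv_apply, map_div₀, complexMGF_conj]
    congr 1
    have h1 := (hasDerivAt_complexMGF (X := X) (μ := P) (z := z) (by simp [hu])).deriv
    have h2 := (hasDerivAt_complexMGF (X := X) (μ := P) (z := starRingEnd ℂ z)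
      (by simp [hu])).deriv
    rw [h1, h2, ← integral_conj]
    congr 1
    ext ω
    rw [map_mul, ← Complex.exp_conj, map_mul, Complex.conj_ofReal]
  have him : ∀ z ∈ Metric.ball (0 : ℂ) h, 0 ≤ z.im →
      0 ≤ (logDeriv (complexMGF X P) z).im := by
    intro z hz hz0
    have hlt := (abs_lt.mp (himlt z hz)).2
    -- The reflection argument needs Im z > 0; on the real axis L is real by symmetry.
    rcases hz0.eq_or_lt with h0 | h0
    · have hzz : starRingEnd ℂ z = z := Complex.conj_eq_iff_im.mpr h0.symm
      have := hconj z
      rw [hzz] at this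
      exact (Complex.conj_eq_iff_im.mp this.symm).ge
    · refine logDeriv_im_nonneg hM complexMGF_conj norm_complexMGF_le_norm_re hnz
        (hgrowth.exists_abs_log_norm_complexMGF_le hδπ) h0 (by linarith) ?_
      have : κ * z.im ≤ κ * h := by gcongr
      linarith [Real.pi_gt_three]
  have hvar : ‖((variance X P : ℝ) : ℂ)‖ = variance X P := by
    rw [Complex.norm_real, Real.norm_of_nonneg (variance_nonneg X P)]
  refine exists_eq_exp_of_logDeriv hM (by simp [complexMGF]) hnzb (fun z hz => ?_) ?_ hh hw
  -- The remainder is proportional to L'(0), the variance; no further moment enters.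
  · have := norm_sub_affine_le_of_typicallyReal hh hLd (fun z _ => hconj z) him hz
    rw [logDeriv_complexMGF_zero hu, deriv_logDeriv_complexMGF_zero hu, hvar] at this
    exact this.trans_eq (by ring)
  · have := variance_nonneg X P
    positivity

end MGF

/-! ### Comparison with the Gaussian. -/

theorem cdf_gaussianReal_sub_le {v : NNReal} (hv : v ≠ 0) {x y : ℝ} (hxy : x ≤ y) :
    cdf (gaussianReal 0 v) y - cdf (gaussianReal 0 v) x ≤ (Real.sqrt v)⁻¹ * (y - x) := by
  have h1 : (gaussianReal 0 v).real (Set.Iic y) - (gaussianReal 0 v).real (Set.Iic x)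
      = (gaussianReal 0 v).real (Set.Ioc x y) := by
    rw [← Set.Iic_union_Ioc_eq_Iic hxy, measureReal_union (Set.Iic_disjoint_Ioc le_rfl)
      measurableSet_Ioc]
    ring
  have hv0 : (0 : ℝ) < v := NNReal.coe_pos.mpr (pos_iff_ne_zero.mpr hv)
  rw [cdf_eq_real, cdf_eq_real, h1, measureReal_def, gaussianReal_apply_eq_integral 0 hv,
    ENNReal.toReal_ofReal (integral_nonneg fun _ => gaussianPDFReal_nonneg _ _ _)]
  have hb : ∀ z, gaussianPDFReal 0 v z ≤ (Real.sqrt v)⁻¹ := by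
    intro z
    rw [gaussianPDFReal]
    calc (Real.sqrt (2 * Real.pi * v))⁻¹ * Real.exp (-(z - 0) ^ 2 / (2 * v))
        ≤ (Real.sqrt v)⁻¹ * 1 := by
          gcongr
          · nlinarith [Real.pi_gt_three]
          · refine Real.exp_le_one_iff.mpr (div_nonpos_of_nonpos_of_nonneg ?_ (by positivity))
            nlinarith [sq_nonneg (z - 0)]
      _ = _ := mul_one _
  calc ∫ z in Set.Ioc x y, gaussianPDFReal 0 v z ≤ ∫ _ in Set.Ioc x y, (Real.sqrt v)⁻¹ :=
        setIntegral_mono (integrable_gaussianPDFReal 0 v).integrableOn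
          (integrableOn_const (by simp)) hb
    _ = _ := by
        rw [setIntegral_const, Real.volume_real_Ioc_of_le hxy, smul_eq_mul, mul_comm]

/-- Uses |exp R - 1| ≤ |R| exp |R|. Of the decay a²/2, a quarter of a² pays for exp |R| and an
eighth for the factor a² ≤ 8 exp(a²/8); an eighth remains. -/
theorem norm_exp_sub_exp_le {s a : ℝ} {R : ℂ} (hs : 0 ≤ s) (hR : ‖R‖ ≤ a ^ 2 / 4)
    (hR' : ‖R‖ ≤ s * a ^ 2) :
    ‖Complex.exp ((-(a ^ 2 / 2) : ℝ) + R) - Complex.exp ((-(a ^ 2 / 2) : ℝ))‖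
      ≤ 8 * s * Real.exp (-(a ^ 2 / 8)) := by
  set y : ℝ := a ^ 2 with hy
  have hy0 : 0 ≤ y := sq_nonneg a
  have h1 : ‖Complex.exp R - 1‖ ≤ s * y * Real.exp (y / 4) := by
    have h := Complex.norm_exp_sub_sum_le_norm_mul_exp R 1
    rw [Finset.sum_range_one, pow_zero, Nat.factorial_zero, Nat.cast_one, div_one, pow_one] at h
    refine h.trans ?_
    gcongr
  have h2 : s * y ≤ 8 * s * Real.exp (y / 8) := by
    nlinarith [Real.add_one_le_exp (y / 8)]
  calc _ = Real.exp (-(y / 2)) * ‖Complex.exp R - 1‖ := by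
        rw [Complex.exp_add, ← Complex.ofReal_exp, ← mul_sub_one, norm_mul, Complex.norm_real,
          Real.norm_of_nonneg (Real.exp_pos _).le]
    _ ≤ Real.exp (-(y / 2)) * (8 * s * Real.exp (y / 8) * Real.exp (y / 4)) := by
        gcongr
        exact h1.trans (by gcongr)
    _ = 8 * s * (Real.exp (-(y / 2)) * Real.exp (y / 8) * Real.exp (y / 4)) := by ring
    _ = _ := by
        rw [← Real.exp_add, ← Real.exp_add]
        congr 2
        ring

/-- The scale h/24 makes the cubic error at most (|t|/4)(σht/24)², since 6/24 = 1/4. For |t| ≤ 1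
this is a quarter of the square in the Gaussian exponent, and the spare |t| is the factor required
by Esseen smoothing. -/
theorem norm_charFun_map_sub_le {Ω : Type*} [MeasurableSpace Ω] {P : Measure Ω}
    [IsProbabilityMeasure P] {X : Ω → ℝ} (hX : AEMeasurable X P) {h σ : ℝ} (hh : 0 < h)
    (hσ : 0 < σ) {m : ℝ}
    (hexp : ∀ w : ℂ, ‖w‖ ≤ h / 2 → ∃ R : ℂ,
      complexMGF X P w = Complex.exp (m * w + (σ ^ 2 : ℝ) * w ^ 2 / 2 + R) ∧
      ‖R‖ ≤ 6 * σ ^ 2 / h * ‖w‖ ^ 3) {v : NNReal} (hv : (v : ℝ) = (σ * (h / 24)) ^ 2)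
    {t : ℝ} (ht : |t| ≤ 1) :
    ‖charFun (P.map fun ω => (X ω - m) * (h / 24)) t - charFun (gaussianReal 0 v) t‖
      ≤ |t| * (2 * Real.exp (-((σ * h) ^ 2 / 4608) * t ^ 2)) := by
  set c : ℝ := h / 24 with hc
  have hc0 : 0 < c := by positivity
  have hnw : ‖((c * t : ℝ) : ℂ) * Complex.I‖ = c * |t| := by
    rw [norm_mul, Complex.norm_I, mul_one, Complex.norm_real, Real.norm_eq_abs, abs_mul,
      abs_of_pos hc0]
  obtain ⟨R, hMR, hR⟩ := hexp ((c * t : ℝ) * Complex.I) (by rw [hnw]; nlinarith)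
  rw [hnw] at hR
  have h1 : charFun (P.map fun ω => (X ω - m) * c) t
      = Complex.exp ((-((σ * c * t) ^ 2 / 2) : ℝ) + R) := by
    rw [← complexMGF_mul_I (by fun_prop)]
    have e : complexMGF (fun ω => (X ω - m) * c) P (t * Complex.I)
        = Complex.exp (-(m * ((c * t : ℝ) * Complex.I)))
          * complexMGF X P ((c * t : ℝ) * Complex.I) := by
      rw [complexMGF, complexMGF, ← integral_const_mul]
      congr 1
      ext ω
      rw [← Complex.exp_add]
      congr 1
      push_cast
      ring
    rw [e, hMR, ← Complex.exp_add]
    congr 1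
    push_cast
    ring_nf
    rw [Complex.I_sq]
    ring
  have h2 : charFun (gaussianReal 0 v) t = Complex.exp ((-((σ * c * t) ^ 2 / 2) : ℝ)) := by
    have hv' : (v : ℂ) = ((σ * c) ^ 2 : ℝ) := by rw [← hv]
    rw [charFun_gaussianReal, hv']
    congr 1
    push_cast
    ring
  rw [h1, h2]
  have hs : ‖R‖ ≤ (|t| / 4) * (σ * c * t) ^ 2 := by
    refine hR.trans_eq ?_
    have : |t| ^ 3 = |t| * t ^ 2 := by rw [pow_succ', sq_abs]
    rw [mul_pow, this, hc]
    field_simp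
    ring
  refine (norm_exp_sub_exp_le (by positivity) ?_ hs).trans_eq ?_
  · refine hs.trans ?_
    nlinarith [sq_nonneg (σ * c * t)]
  · have : -((σ * h) ^ 2 / 4608) * t ^ 2 = -((σ * c * t) ^ 2 / 8) := by rw [hc]; ring
    rw [this]; ring

theorem integral_gaussian_Icc_le {b : ℝ} (hb : 0 < b) :
    ∫ t in (-1 : ℝ)..1, 2 * Real.exp (-b * t ^ 2) ≤ 2 * Real.sqrt (Real.pi / b) := by
  rw [← integral_gaussian, intervalIntegral.integral_const_mul,
    intervalIntegral.integral_of_le (by norm_num)]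
  refine mul_le_mul_of_nonneg_left ?_ two_pos.le
  exact setIntegral_le_integral (integrable_exp_neg_mul_sq hb)
    (ae_of_all _ fun _ => (Real.exp_pos _).le)

/-! ### Assembly and constants. -/

theorem mainTheorem4 {Ω : Type*} [MeasurableSpace Ω] (P : Measure Ω) [IsProbabilityMeasure P]
    (X : Ω → ℝ) (hX : AEMeasurable X P)
    (δ κ : ℝ) (hδ : 0 < δ) (hδπ : δ ≤ Real.pi) (hκ : 0 < κ)
    -- the generating function is finite on the positive reals
    (hfin : ∀ ρ : ℝ, 0 < ρ → Integrable (fun ω => ρ ^ (X ω)) P)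
    (hzero : ∀ z ∈ sector δ, probGenFun X P z ≠ 0)
    (hgrowth : GrowthCondition κ δ (logPotential X P))
    (hσ : 0 < stdDev X P) :
    (⨆ t : ℝ, |P.real {ω | standardize X P ω ≤ t} - (gaussianReal 0 1).real (Set.Iic t)|)
      ≤ (2 : ℝ) ^ 3258 * (max δ⁻¹ κ / stdDev X P) := by
  set K : ℝ := max δ⁻¹ κ with hK
  have hK0 : 0 < K := lt_max_of_lt_right hκ
  set σ : ℝ := stdDev X P with hσdef
  set m : ℝ := ∫ ω, X ω ∂P with hm
  have hvar : variance X P = σ ^ 2 := (Real.sq_sqrt (variance_nonneg X P)).symm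
  set h : ℝ := 1 / (2 * K) with hh
  have hh0 : 0 < h := by positivity
  have hhδ : 2 * h ≤ δ := by
    have h1 : δ⁻¹ ≤ K := le_max_left _ _
    have h2 : 2 * h = K⁻¹ := by rw [hh]; field_simp
    rw [h2]
    exact inv_le_of_inv_le₀ hδ h1
  have hhκ : κ * h ≤ 1 := by
    have h1 : κ ≤ K := le_max_right _ _
    rw [hh, mul_one_div, div_le_one (by positivity)]
    linarith
  have hexp : ∀ w : ℂ, ‖w‖ ≤ h / 2 → ∃ R : ℂ,
      complexMGF X P w = Complex.exp (m * w + (σ ^ 2 : ℝ) * w ^ 2 / 2 + R) ∧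
      ‖R‖ ≤ 6 * σ ^ 2 / h * ‖w‖ ^ 3 := by
    intro w hw
    rw [← hvar]
    exact exists_complexMGF_eq_exp hδπ (integrableExpSet_eq_univ hfin) hzero hgrowth hh0 hhδ
      hhκ hκ hw
  -- T is the standard deviation of (X - m)h/24. Rescaling both laws by T instead of standardizing
  -- keeps the frequency range equal to [-1, 1].
  set T : ℝ := σ * (h / 24) with hT
  have hT0 : 0 < T := by positivity
  set v : NNReal := .mk (T ^ 2) (sq_nonneg T) with hvdef
  have hv : (v : ℝ) = T ^ 2 := rfl
  have hv0 : v ≠ 0 := by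
    rw [← NNReal.coe_ne_zero, hv]; positivity
  have hYm : AEMeasurable (fun ω => (X ω - m) * (h / 24)) P := by fun_prop
  set ρ : Measure ℝ := P.map fun ω => (X ω - m) * (h / 24) with hρ
  have : IsProbabilityMeasure ρ := Measure.isProbabilityMeasure_map hYm
  set b : ℝ := (σ * h) ^ 2 / 4608 with hb
  have hb0 : 0 < b := by positivity
  have hint : ∫ t in (-1 : ℝ)..1, 2 * Real.exp (-b * (-t) ^ 2) ≤ 256 / (σ * h) := by
    simp_rw [neg_sq]
    refine (integral_gaussian_Icc_le hb0).trans ?_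
    -- Amounts to 4608π ≤ 128².
    have h1 : Real.sqrt (Real.pi / b) ≤ 128 / (σ * h) := by
      refine Real.sqrt_le_iff.mpr ⟨by positivity, ?_⟩
      rw [hb, div_div_eq_mul_div, div_pow]
      gcongr
      linarith [Real.pi_lt_d2]
    calc 2 * Real.sqrt (Real.pi / b) ≤ 2 * (128 / (σ * h)) := by gcongr
      _ = _ := by ring
  refine ciSup_le fun t => ?_
  have hcdf := abs_cdf_sub_cdf_le ρ (gaussianReal 0 v)
    (w := fun t => 2 * Real.exp (-b * t ^ 2)) (by fun_prop) (fun t => by positivity)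
    (fun t ht => norm_charFun_map_sub_le hX hh0 hσ hexp hv ht) (ε := T⁻¹) (by positivity)
    (fun x y hxy => by
      have := cdf_gaussianReal_sub_le hv0 hxy
      rwa [hv, Real.sqrt_sq hT0.le] at this) (T * t)
  have e1 : cdf ρ (T * t) = P.real {ω | standardize X P ω ≤ t} := by
    rw [cdf_eq_real, hρ, measureReal_def, Measure.map_apply_of_aemeasurable hYm measurableSet_Iic,
      measureReal_def]
    congr 2
    ext ω
    simp only [Set.mem_preimage, Set.mem_Iic, Set.mem_ofPred_eq, standardize, ← hm, ← hσdef]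
    rw [div_le_iff₀ hσ, hT, mul_right_comm, mul_le_mul_iff_left₀ (by positivity), mul_comm]
  have e2 : cdf (gaussianReal 0 v) (T * t) = (gaussianReal 0 1).real (Set.Iic t) := by
    have hmap := gaussianReal_map_const_mul (μ := 0) (v := 1) T
    rw [mul_zero, mul_one] at hmap
    rw [cdf_eq_real, hvdef, ← hmap, measureReal_def,
      Measure.map_apply (by fun_prop) measurableSet_Iic, measureReal_def]
    congr 2
    ext x
    simp only [Set.mem_preimage, Set.mem_Iic]
    exact mul_le_mul_iff_right₀ hT0
  rw [e1, e2] at hcdf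
  refine hcdf.trans ?_
  calc 512 * T⁻¹ + 4 * ∫ t in (-1 : ℝ)..1, 2 * Real.exp (-b * (-t) ^ 2)
      ≤ 512 * T⁻¹ + 4 * (256 / (σ * h)) := by gcongr
    -- With h = 1/(2K) the two terms are 512 · 48 and 1024 · 2 times K/σ; the power of 2 in the
    -- statement is far from needed.
    _ = 26624 * (K / σ) := by rw [hT, hh]; field_simp; norm_num
    _ ≤ (2 : ℝ) ^ 3258 * (K / σ) := by
        gcongr
        calc (26624 : ℝ) ≤ 2 ^ 15 := by norm_num
          _ ≤ 2 ^ 3258 := pow_le_pow_right₀ (by norm_num) (by norm_num)
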